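/- Let $G$ be a finite connected graph without loops (multiple edges allowed) with vertices $v_1,\dots,v_n$, $n\ge 3$, and let $\delta_{i,j}$ be the number of edges between $v_i$ and $v_j$. Let $(\mathbf d,\mathbf r)\in(\mathbb Z_{\ge 0})^n\times(\mathbb Z_{>0})^n$ be an arithmetical structure on $G$: $\gcd(r_1,\dots,r_n)=1$ and $L\mathbf r=\mathbf 0$, where $L=\operatorname{diag}(\mathbf d)-A$ and $A=(\delta_{i,j})$ is the adjacency matrix of $G$. Let $(G',\mathbf d',\mathbf r')$ be the result of the Keyes–Reiter generalized star-clique operation at $v_n$: $G'$ is the loopless graph on $v_1,\dots,v_{n-1}$ with $\delta'_{i,j}=\delta_{i,j}d_n+\delta_{i,n}\delta_{n,j}$ edges between $v_i$ and $v_j$ for $i\ne j$, and $d'_i=d_id_n-\delta_{i,n}\delta_{n,i}$, $r'_i=r_i/\gcd(r_1,\dots,r_{n-1})$ for $1\le i\le n-1$. Put $L'=\operatorname{diag}(\mathbf d')-A'$, where $A'=(\delta'_{i,j})$ is the adjacency matrix of $G'$. The matrices $L$ and $L'$ have ranks $n-1$ and $n-2$; let $\alpha_1\mid\alpha_2\mid\dots\mid\alpha_{n-1}$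 and $\alpha'_1\mid\dots\mid\alpha'_{n-2}$ be their invariant factors, that is, the positive diagonal entries of their Smith normal forms over $\mathbb Z$. Let $\mathcal K(G';\mathbf d',\mathbf r')$ be the critical group, the torsion subgroup of $\mathbb Z^{n-1}/\operatorname{im}(L')$, and let $g_n(L)$ be the greatest common divisor of the entries of the last row of $L$. If $g_n(L)=1$ (which holds, for instance, whenever $G$ is simple), then $\alpha'_1=\alpha_2$ and $\alpha'_k=d_n\alpha_{k+1}$ for all $2\le k\le n-2$. In particular, $$\mathcal K(G';\mathbf d',\mathbf r')\cong \mathbb Z/\alpha_2\mathbb Z\oplus\bigoplus_{k=2}^{n-2}\mathbb Z/d_n\alpha_{k+1}\mathbb Z .$$ -/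

import Mathlib

open scoped DirectSum

/-- A multigraph without loops on the vertex set `V`: `mult i j` is the number of edges
between the vertices `i` and `j`. -/
structure Multigraph (V : Type*) where
  mult : V → V → ℕ
  symm : ∀ i j, mult i j = mult j i
  loopless : ∀ i, mult i i = 0

namespace Multigraph

/-- The simple graph in which two vertices are adjacent when some edge joins them. -/
def toSimpleGraph {V : Type*} (G : Multigraph V) : SimpleGraph V where
  Adj i j := G.mult i j ≠ 0
  symm := ⟨fun i j h => by rwa [G.symm j i]⟩
  loopless := ⟨fun i h => h (G.loopless i)⟩

/-- A multigraph is connected when any two vertices are joined by a path. -/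
def Connected {V : Type*} (G : Multigraph V) : Prop := G.toSimpleGraph.Connected

/-- A (loopless) multigraph is simple when it has no multiple edges. -/
def IsSimple {V : Type*} (G : Multigraph V) : Prop := ∀ i j, G.mult i j ≤ 1

/-- The adjacency matrix. -/
def adjMatrix {V : Type*} (G : Multigraph V) : Matrix V V ℤ :=
  Matrix.of fun i j => (G.mult i j : ℤ)

end Multigraph

/-- An arithmetical structure `(d, r)` on a multigraph: `d` has nonnegative integer entries,
`r` has positive integer entries with greatest common divisor `1`, and
`d i * r i = ∑ j, (number of edges between i and j) * r j` for all `i`, that is,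
`(diag d - A) r = 0`. -/
structure ArithmeticalStructure {V : Type*} [Fintype V] (G : Multigraph V) where
  d : V → ℕ
  r : V → ℕ
  r_pos : ∀ i, 0 < r i
  d_mul_r : ∀ i, d i * r i = ∑ j, G.mult i j * r j
  gcd_r : Finset.univ.gcd r = 1

namespace ArithmeticalStructure

/-- The matrix `L = diag d - A`. -/
def L {V : Type*} [Fintype V] [DecidableEq V] {G : Multigraph V}
    (a : ArithmeticalStructure G) : Matrix V V ℤ :=
  Matrix.diagonal (fun i => (a.d i : ℤ)) - G.adjMatrix

/-- The critical group of `(G, d, r)`: the torsion subgroup of the cokernel of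
`L : ℤ^V → ℤ^V`. -/
abbrev CriticalGroup {V : Type*} [Fintype V] [DecidableEq V] {G : Multigraph V}
    (a : ArithmeticalStructure G) : Type _ :=
  AddCommGroup.torsion ((V → ℤ) ⧸ LinearMap.range (Matrix.mulVecLin a.L))

end ArithmeticalStructure

namespace Multigraph

/-- The graph obtained from a graph `G` on `Fin (m + 1)` by the Keyes–Reiter generalized
star-clique operation at the last vertex, where `dn` is the last entry of `d`. -/
def starClique {m : ℕ} (G : Multigraph (Fin (m + 1))) (dn : ℕ) : Multigraph (Fin m) where
  mult i j :=
    if i = j then 0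
    else G.mult i.castSucc j.castSucc * dn
      + G.mult i.castSucc (Fin.last m) * G.mult (Fin.last m) j.castSucc
  symm i j := by
    by_cases h : i = j
    · simp [h]
    · rw [if_neg h, if_neg (Ne.symm h), G.symm i.castSucc j.castSucc,
        G.symm i.castSucc (Fin.last m), G.symm (Fin.last m) j.castSucc]
      ring
  loopless i := by simp

end Multigraph

namespace ArithmeticalStructure

/-- The subtraction in the definition of `d'` below never truncates. -/
theorem mult_mul_mult_le {m : ℕ} {G : Multigraph (Fin (m + 1))} (a : ArithmeticalStructure G)
    (i : Fin m) :
    G.mult i.castSucc (Fin.last m) * G.mult (Fin.last m) i.castSucc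
      ≤ a.d i.castSucc * a.d (Fin.last m) := by
  have key : ∀ x y, G.mult x y * a.r y ≤ a.d x * a.r x := fun x y => by
    rw [a.d_mul_r x]
    exact Finset.single_le_sum (f := fun j => G.mult x j * a.r j)
      (fun _ _ => Nat.zero_le _) (Finset.mem_univ y)
  have h := Nat.mul_le_mul (key i.castSucc (Fin.last m)) (key (Fin.last m) i.castSucc)
  refine Nat.le_of_mul_le_mul_right (c := a.r i.castSucc * a.r (Fin.last m)) ?_
    (Nat.mul_pos (a.r_pos _) (a.r_pos _))
  calc _ = _ := by ring
    _ ≤ _ := h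
    _ = _ := by ring

/-- The arithmetical structure `(d', r')` on the graph `G'` produced by the Keyes–Reiter
generalized star-clique operation at the last vertex of a graph with `m + 1 ≥ 2` vertices:
`d' i = d i * d n - δ i n * δ n i` and `r' i = r i / gcd (r 1, …, r (n - 1))`. -/
def starClique {m : ℕ} {G : Multigraph (Fin (m + 1))} (a : ArithmeticalStructure G)
    (hm : 0 < m) : ArithmeticalStructure (G.starClique (a.d (Fin.last m))) where
  d i := a.d i.castSucc * a.d (Fin.last m)
    - G.mult i.castSucc (Fin.last m) * G.mult (Fin.last m) i.castSucc
  r i := a.r i.castSucc / Finset.univ.gcd (fun j : Fin m => a.r j.castSucc)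
  r_pos i := by
    have hd : Finset.univ.gcd (fun j : Fin m => a.r j.castSucc) ∣ a.r i.castSucc :=
      Finset.gcd_dvd (f := fun j : Fin m => a.r j.castSucc) (Finset.mem_univ i)
    exact Nat.div_pos (Nat.le_of_dvd (a.r_pos _) hd) (Nat.pos_of_dvd_of_pos hd (a.r_pos _))
  d_mul_r i := by
    have hd : ∀ i : Fin m,
        Finset.univ.gcd (fun j : Fin m => a.r j.castSucc) ∣ a.r i.castSucc := fun i =>
      Finset.gcd_dvd (f := fun j : Fin m => a.r j.castSucc) (Finset.mem_univ i)
    have hg := Nat.pos_of_dvd_of_pos (hd i) (a.r_pos _)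
    have hle := a.mult_mul_mult_le i
    have hi := a.d_mul_r i.castSucc
    have hn := a.d_mul_r (Fin.last m)
    rw [Fin.sum_univ_castSucc] at hi hn
    rw [G.loopless, zero_mul, add_zero] at hn
    refine Nat.eq_of_mul_eq_mul_right hg ?_
    rw [mul_assoc, Nat.div_mul_cancel (hd i), Finset.sum_mul]
    simp_rw [mul_assoc, Nat.div_mul_cancel (hd _)]
    have hs : ∀ j : Fin m, (G.starClique (a.d (Fin.last m))).mult i j * a.r j.castSucc
        + (if i = j then G.mult i.castSucc (Fin.last m) * G.mult (Fin.last m) i.castSucc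
            * a.r i.castSucc else 0)
        = a.d (Fin.last m) * (G.mult i.castSucc j.castSucc * a.r j.castSucc)
          + G.mult i.castSucc (Fin.last m)
            * (G.mult (Fin.last m) j.castSucc * a.r j.castSucc) := fun j => by
      by_cases h : i = j
      · subst h
        simp only [Multigraph.starClique, if_true, G.loopless]
        ring
      · simp only [Multigraph.starClique, if_neg h]
        ring
    have ht := Finset.sum_congr (rfl : (Finset.univ : Finset (Fin m)) = _) (fun j _ => hs j)
    rw [Finset.sum_add_distrib, Finset.sum_add_distrib, Finset.sum_ite_eq, if_pos
      (Finset.mem_univ i), ← Finset.mul_sum, ← Finset.mul_sum, ← hn] at ht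
    zify [hle] at ht hi ⊢
    linear_combination (a.d (Fin.last m) : ℤ) * hi - ht
  gcd_r := Finset.gcd_div_eq_one (Finset.mem_univ (⟨0, hm⟩ : Fin m)) (a.r_pos _).ne'

end ArithmeticalStructure

/-- The (nonnegative) greatest common divisor of the entries of row `i` of `B`. -/
def rowGcd {m n : ℕ} (B : Matrix (Fin m) (Fin n) ℤ) (i : Fin m) : ℤ :=
  Finset.univ.gcd fun j => B i j

/-- `α 1, …, α t` are the invariant factors of the integer matrix `B`: they are positive, each
divides the next, and for some matrices `S`, `T` invertible over `ℤ` the matrix `S * B * T`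
(the Smith normal form of `B`) has `α 1, …, α t, 0, …, 0` on its diagonal and zeros elsewhere.
In particular `t` is the rank of `B`. -/
structure IsInvariantFactors {m n : ℕ} (B : Matrix (Fin m) (Fin n) ℤ) (t : ℕ) (α : ℕ → ℕ) :
    Prop where
  le_rows : t ≤ m
  le_cols : t ≤ n
  pos : ∀ k, 1 ≤ k → k ≤ t → 0 < α k
  dvd : ∀ k, 1 ≤ k → k < t → α k ∣ α (k + 1)
  smith : ∃ (S : (Matrix (Fin m) (Fin m) ℤ)ˣ) (T : (Matrix (Fin n) (Fin n) ℤ)ˣ),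
    (S : Matrix (Fin m) (Fin m) ℤ) * B * (T : Matrix (Fin n) (Fin n) ℤ) =
      Matrix.of fun (i : Fin m) (j : Fin n) =>
        if (i : ℕ) = (j : ℕ) ∧ (i : ℕ) < t then (α ((i : ℕ) + 1) : ℤ) else 0

/-!
Put the last vertex first, so that `L = [[d, -c], [-c, M]]`, where `d` is the diagonal entry
at the last vertex and `c` counts the edges there. The matrix of the star-clique operation is then
`L' = d M - c cᵀ`, an integral Schur complement.

A unimodular change of basis makes `c` a multiple `g e₀` of the first unit vector. When the last
row of `L` has greatest common divisor `1`, `g` is prime to `d`, and column operations on the first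
two columns show that `L` is equivalent to `1 ⊕ N`, where `L'` is `N` with all columns but the first
multiplied by `d`. The corner of `N` is congruent to `-g²` modulo `d`, hence prime to `d`. Under that
condition, scaling the other columns by `d` multiplies all invariant factors but the first by `d`
(`Matrix.UnimodularEquiv.mul_border_smul`), whence
`Matrix.exists_diagonal_border_and_schur`: if `L` has the diagonal form `1, β₀, β₁, …`, then `L'` has
the diagonal form `β₀, d β₁, d β₂, …`.

The rest identifies these diagonal entries with the invariant factors: the Smith normal form
exists and is unique (`Matrix.UnimodularEquiv.exists_diagonal`,
`Matrix.UnimodularEquiv.diagonal_unique`), only the last diagonal entry of the form for `L` is zero,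
because a maximum principle shows that the kernel of `L` is spanned by `r`
(`ArithmeticalStructure.diagonal_eq_zero_iff`), and the torsion of a cokernel is read off from the
nonzero diagonal entries (`Matrix.UnimodularEquiv.nonempty_torsion_addEquiv`).
-/

namespace Matrix

/-! ### Unimodular equivalence and bordered matrices -/

/-- Two square integer matrices are unimodularly equivalent when one is obtained from the other
by multiplying on both sides with matrices invertible over `ℤ`. -/
def UnimodularEquiv {n : Type*} [Fintype n] [DecidableEq n] (A B : Matrix n n ℤ) : Prop :=
  ∃ S T : (Matrix n n ℤ)ˣ, (S : Matrix n n ℤ) * A * (T : Matrix n n ℤ) = B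

namespace UnimodularEquiv

variable {n : Type*} [Fintype n] [DecidableEq n] {A B C : Matrix n n ℤ}

theorem of_isUnit {S T : Matrix n n ℤ} (hS : IsUnit S) (hT : IsUnit T) (h : S * A * T = B) :
    UnimodularEquiv A B :=
  ⟨hS.unit, hT.unit, h⟩

theorem refl (A : Matrix n n ℤ) : UnimodularEquiv A A := ⟨1, 1, by simp⟩

theorem symm (h : UnimodularEquiv A B) : UnimodularEquiv B A := by
  obtain ⟨S, T, rfl⟩ := h
  exact ⟨S⁻¹, T⁻¹, by simp [Matrix.mul_assoc]⟩

theorem trans (h : UnimodularEquiv A B) (h' : UnimodularEquiv B C) : UnimodularEquiv A C := by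
  obtain ⟨S, T, rfl⟩ := h
  obtain ⟨S', T', rfl⟩ := h'
  exact ⟨S' * S, T * T', by simp [Matrix.mul_assoc]⟩

theorem neg (A : Matrix n n ℤ) : UnimodularEquiv A (-A) := ⟨-1, 1, by simp⟩

/-- Permuting rows and columns is a unimodular equivalence. -/
theorem submatrix (A : Matrix n n ℤ) (σ τ : Equiv.Perm n) :
    UnimodularEquiv A (A.submatrix σ τ) := by
  have hu : ∀ σ : Equiv.Perm n, IsUnit ((1 : Matrix n n ℤ).submatrix σ id) := fun σ => by
    refine IsUnit.of_mul_eq_one ((1 : Matrix n n ℤ).submatrix id σ) ?_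
    rw [← submatrix_mul _ _ _ _ _ Function.bijective_id, Matrix.mul_one, submatrix_one_equiv]
  have hu' : ∀ σ : Equiv.Perm n, IsUnit ((1 : Matrix n n ℤ).submatrix id σ) := fun σ => by
    have h := (isUnit_iff_isUnit_det _).mp (hu σ)
    rwa [← det_transpose, transpose_submatrix, transpose_one, ← isUnit_iff_isUnit_det] at h
  refine of_isUnit (hu σ) (hu' τ) ?_
  ext i j
  simp [Matrix.mul_apply, Matrix.one_apply]

end UnimodularEquiv

/-- The matrix `[[a, r], [c, M]]` with corner `a`, first row `(a, r)`, first column `(a, c)` and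
remaining block `M`. -/
def border {n : ℕ} (a : ℤ) (r c : Fin n → ℤ) (M : Matrix (Fin n) (Fin n) ℤ) :
    Matrix (Fin (n + 1)) (Fin (n + 1)) ℤ :=
  of (Fin.cons (Fin.cons a r) fun i => Fin.cons (c i) (M i))

section border

variable {n : ℕ} (a : ℤ) (r c : Fin n → ℤ) (M : Matrix (Fin n) (Fin n) ℤ)

@[simp] theorem border_zero_zero : border a r c M 0 0 = a := rfl

@[simp] theorem border_zero_succ (j : Fin n) : border a r c M 0 j.succ = r j := rfl

@[simp] theorem border_succ_zero (i : Fin n) : border a r c M i.succ 0 = c i := rfl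

@[simp] theorem border_succ_succ (i j : Fin n) : border a r c M i.succ j.succ = M i j := rfl

theorem ext_border {A B : Matrix (Fin (n + 1)) (Fin (n + 1)) ℤ} (h00 : A 0 0 = B 0 0)
    (h0 : ∀ j : Fin n, A 0 j.succ = B 0 j.succ) (h1 : ∀ i : Fin n, A i.succ 0 = B i.succ 0)
    (h2 : ∀ i j : Fin n, A i.succ j.succ = B i.succ j.succ) : A = B := by
  ext i j
  refine Fin.cases ?_ (fun i => ?_) i <;> refine Fin.cases ?_ (fun j => ?_) j
  exacts [h00, h0 j, h1 i, h2 i j]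

theorem eq_border (A : Matrix (Fin (n + 1)) (Fin (n + 1)) ℤ) :
    A = border (A 0 0) (fun j => A 0 j.succ) (fun i => A i.succ 0)
      (A.submatrix Fin.succ Fin.succ) :=
  ext_border rfl (fun _ => rfl) (fun _ => rfl) fun _ _ => rfl

theorem border_one : border 1 0 0 (1 : Matrix (Fin n) (Fin n) ℤ) = 1 :=
  ext_border rfl (fun j => by simp [(Fin.succ_ne_zero j).symm])
    (fun i => by simp) fun i j => by simp [Matrix.one_apply]

theorem border_diagonal (a : ℤ) (v : Fin n → ℤ) :
    border a 0 0 (diagonal v) = diagonal (Fin.cons a v : Fin (n + 1) → ℤ) :=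
  ext_border (by simp) (fun j => by simp [(Fin.succ_ne_zero j).symm])
    (fun i => by simp) fun i j => by simp [diagonal_apply]

theorem border_mul (a' : ℤ) (r' c' : Fin n → ℤ) (M' : Matrix (Fin n) (Fin n) ℤ) :
    border a r c M * border a' r' c' M' =
      border (a * a' + r ⬝ᵥ c') (a • r' + r ᵥ* M') (a' • c + M *ᵥ c')
        (vecMulVec c r' + M * M') := by
  refine ext_border ?_ (fun j => ?_) (fun i => ?_) fun i j => ?_ <;>
    simp [Matrix.mul_apply, Fin.sum_univ_succ, dotProduct, mulVec, vecMul, vecMulVec_apply,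
      mul_comm]

theorem isUnit_border_col : IsUnit (border 1 0 c 1) := by
  refine IsUnit.of_mul_eq_one (border 1 0 (-c) 1) ?_
  rw [border_mul, ← border_one]
  simp

theorem isUnit_border_row : IsUnit (border 1 r 0 1) := by
  refine IsUnit.of_mul_eq_one (border 1 (-r) 0 1) ?_
  rw [border_mul, ← border_one]
  simp

theorem isUnit_border_block {M : Matrix (Fin n) (Fin n) ℤ} (hM : IsUnit M) :
    IsUnit (border 1 0 0 M) := by
  obtain ⟨M, rfl⟩ := hM
  refine IsUnit.of_mul_eq_one (border 1 0 0 (↑M⁻¹ : Matrix (Fin n) (Fin n) ℤ)) ?_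
  rw [border_mul, ← border_one]
  simp

theorem UnimodularEquiv.border {M M' : Matrix (Fin n) (Fin n) ℤ} (h : UnimodularEquiv M M') :
    UnimodularEquiv (border a 0 0 M) (border a 0 0 M') := by
  obtain ⟨S, T, rfl⟩ := h
  refine of_isUnit (isUnit_border_block S.isUnit) (isUnit_border_block T.isUnit) ?_
  rw [border_mul, border_mul]
  simp

end border

/-! ### Existence of the Smith normal form -/

theorem isUnit_transvection {n : Type*} [Fintype n] [DecidableEq n] {i j : n} (h : i ≠ j)
    (c : ℤ) : IsUnit (transvection i j c) := by
  rw [isUnit_iff_isUnit_det, det_transvection_of_ne _ _ h]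
  exact isUnit_one

/-- A nonzero integer matrix is equivalent to one with an entry dividing all entries, namely the
smallest positive integer that occurs as an entry of an equivalent matrix. -/
theorem UnimodularEquiv.exists_entry_dvd {n : ℕ} {A : Matrix (Fin n) (Fin n) ℤ} (hA : A ≠ 0) :
    ∃ (g : ℕ) (B : Matrix (Fin n) (Fin n) ℤ) (i j : Fin n), UnimodularEquiv A B ∧
      B i j = g ∧ g ≠ 0 ∧ ∀ i' j', (g : ℤ) ∣ B i' j' := by
  classical
  let P : ℕ → Prop := fun g => g ≠ 0 ∧ ∃ (B : Matrix (Fin n) (Fin n) ℤ) (i j : Fin n),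
    UnimodularEquiv A B ∧ B i j = g
  have hP : ∃ g, P g := by
    obtain ⟨i, j, hij⟩ : ∃ i j, A i j ≠ 0 := by
      by_contra! h
      exact hA (Matrix.ext h)
    refine ⟨(A i j).natAbs, Int.natAbs_ne_zero.mpr hij, ?_⟩
    rcases Int.natAbs_eq (A i j) with h | h
    · exact ⟨A, i, j, refl A, h⟩
    · exact ⟨-A, i, j, neg A, by rw [neg_apply]; lia⟩
  set g := Nat.find hP with hg
  obtain ⟨hg0, B, i, j, hB, hBij⟩ : P g := Nat.find_spec hP
  have hmin : ∀ (x : ℤ) (D : Matrix (Fin n) (Fin n) ℤ) (a b : Fin n), UnimodularEquiv A D →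
      D a b = x % g → (g : ℤ) ∣ x := fun x D a b hD hDab => by
    by_contra hdvd
    have h0 : 0 ≤ x % g := Int.emod_nonneg _ (by exact_mod_cast hg0)
    have hlt : x % g < g := Int.emod_lt_of_pos _ (by positivity)
    have hne : x % g ≠ 0 := fun h => hdvd (Int.dvd_of_emod_eq_zero h)
    have := Nat.find_min hP (m := (x % g).toNat) (by rw [← hg]; lia)
    exact this ⟨by lia, D, a, b, hD, by rw [hDab]; lia⟩
  -- A minimal entry divides its row and its column, because one elementary operation replaces
  -- any other entry there by its remainder.
  have hcol : ∀ (C : Matrix (Fin n) (Fin n) ℤ) (a b : Fin n), UnimodularEquiv A C →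
      C a b = g → ∀ a', (g : ℤ) ∣ C a' b := fun C a b hC hab a' => by
    by_cases h : a' = a
    · rw [h, hab]
    refine hmin (C a' b) (transvection a' a (-(C a' b / g)) * C) a' b
      (hC.trans (of_isUnit (T := 1) (isUnit_transvection h _) isUnit_one (mul_one _))) ?_
    rw [transvection_mul_apply_same, hab, Int.emod_def]
    ring
  have hrow : ∀ (C : Matrix (Fin n) (Fin n) ℤ) (a b : Fin n), UnimodularEquiv A C →
      C a b = g → ∀ b', (g : ℤ) ∣ C a b' := fun C a b hC hab b' => by
    by_cases h : b' = b
    · rw [h, hab]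
    refine hmin (C a b') (C * transvection b b' (-(C a b' / g))) a b'
      (hC.trans (of_isUnit (S := 1) isUnit_one (isUnit_transvection (Ne.symm h) _)
        (by rw [one_mul]))) ?_
    rw [mul_transvection_apply_same, hab, Int.emod_def]
    ring
  refine ⟨g, B, i, j, hB, hBij, hg0, fun i' j' => ?_⟩
  by_cases h : i' = i
  · rw [h]; exact hrow B i j hB hBij j'
  -- A multiple of row `i` added to row `i'` puts the minimal entry into position `(i', j)`.
  obtain ⟨q, hq⟩ := hcol B i j hB hBij i'
  have hE := hrow (transvection i' i (1 - q) * B) i' j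
    (hB.trans (of_isUnit (T := 1) (isUnit_transvection h _) isUnit_one (mul_one _)))
    (by rw [transvection_mul_apply_same, hBij, hq]; ring) j'
  rw [transvection_mul_apply_same] at hE
  exact (dvd_add_left ((hrow B i j hB hBij j').mul_left _)).mp hE

/-- Existence of the Smith normal form over `ℤ`, for square matrices. -/
theorem UnimodularEquiv.exists_diagonal {n : ℕ} (A : Matrix (Fin n) (Fin n) ℤ) :
    ∃ e : Fin n → ℕ, (∀ i j, i ≤ j → e i ∣ e j) ∧
      UnimodularEquiv A (diagonal fun i => (e i : ℤ)) := by
  induction n with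
  | zero => exact ⟨0, fun i => i.elim0, by simpa [Subsingleton.elim _ A] using refl A⟩
  | succ n ih =>
    by_cases hA : A = 0
    · exact ⟨0, fun _ _ _ => dvd_rfl, by simpa [hA] using refl _⟩
    obtain ⟨g, B, i, j, hB, hij, -, hdvd⟩ := exists_entry_dvd hA
    have hB' := hB.trans (submatrix B (Equiv.swap 0 i) (Equiv.swap 0 j))
    set B' := B.submatrix (Equiv.swap 0 i) (Equiv.swap 0 j) with hBdef
    have h00 : B' 0 0 = g := by simp [hBdef, hij]
    have hdvd' : ∀ a b, (g : ℤ) ∣ B' a b := fun a b => hdvd _ _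
    choose D hD using hdvd'
    -- Clearing the first row and column leaves `g * C`, since `g` divides all entries.
    set C : Matrix (Fin n) (Fin n) ℤ :=
      of fun i j => D i.succ j.succ - D i.succ 0 * D 0 j.succ with hC
    have hfac : B' = Matrix.border 1 0 (fun i => D i.succ 0) 1 *
        Matrix.border g 0 0 ((g : ℤ) • C) *
        Matrix.border 1 (fun j => D 0 j.succ) 0 1 := by
      rw [border_mul, border_mul]
      refine ext_border (by simp [h00]) (fun j => ?_) (fun i => ?_) fun i j => ?_
      · simp [hD 0 j.succ]
      · simp [hD i.succ 0]
      · simp [hD i.succ j.succ, vecMulVec_apply, hC]; ring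
    obtain ⟨e, he, S, T, hST⟩ := ih C
    have hgC : UnimodularEquiv ((g : ℤ) • C) (diagonal fun i => ((g * e i : ℕ) : ℤ)) := by
      refine ⟨S, T, ?_⟩
      rw [Matrix.mul_smul, Matrix.smul_mul, hST]
      ext i j
      simp [diagonal_apply]
    refine ⟨Fin.cons g fun i => g * e i, ?_, ?_⟩
    · intro i j
      refine Fin.cases ?_ (fun i => ?_) i <;> refine Fin.cases ?_ (fun j => ?_) j
      · simp
      · simp
      · simp
      · intro h
        simpa using Nat.mul_dvd_mul_left g (he i j (Fin.succ_le_succ_iff.mp h))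
    · have h1 := hB'.trans (symm (of_isUnit (isUnit_border_col _) (isUnit_border_row _) hfac.symm))
      have h2 := h1.trans (border g hgC)
      rw [border_diagonal] at h2
      convert h2 using 2
      ext i
      refine Fin.cases ?_ (fun i => ?_) i <;> simp

/-! ### Uniqueness of the Smith normal form -/

theorem card_ker_diagonal_zmod {n : ℕ} (q : ℕ) [NeZero q] (e : Fin n → ℕ) :
    Nat.card {x : Fin n → ZMod q // (diagonal fun i => (e i : ZMod q)) *ᵥ x = 0} =
      ∏ i, Nat.card {x : ZMod q // (e i : ZMod q) * x = 0} := by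
  rw [← Nat.card_pi]
  refine Nat.card_congr ((Equiv.subtypeEquivRight fun x => ?_).trans
    (Equiv.subtypePiEquivPi (p := fun i x => (e i : ZMod q) * x = 0)))
  simp [funext_iff, mulVec_diagonal]

/-- The number of solutions modulo `q` of the homogeneous system with matrix `A` is an invariant of
unimodular equivalence. -/
theorem UnimodularEquiv.card_ker_zmod {n : ℕ} (q : ℕ) {A B : Matrix (Fin n) (Fin n) ℤ}
    (h : UnimodularEquiv A B) :
    Nat.card {x : Fin n → ZMod q // A.map (Int.castRingHom (ZMod q)) *ᵥ x = 0} =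
      Nat.card {x : Fin n → ZMod q // B.map (Int.castRingHom (ZMod q)) *ᵥ x = 0} := by
  obtain ⟨S, T, rfl⟩ := h
  set f : Matrix (Fin n) (Fin n) ℤ →+* Matrix (Fin n) (Fin n) (ZMod q) :=
    (Int.castRingHom (ZMod q)).mapMatrix with hf
  set S' := Units.map f.toMonoidHom S with hS
  set T' := Units.map f.toMonoidHom T with hT
  have hST : ((S : Matrix (Fin n) (Fin n) ℤ) * A * (T : Matrix (Fin n) (Fin n) ℤ)).map
      (Int.castRingHom (ZMod q)) = S' * A.map (Int.castRingHom (ZMod q)) * T' :=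
    (map_mul f _ _).trans (by rw [map_mul]; rfl)
  rw [hST]
  refine Nat.card_congr ⟨fun x => ⟨(↑T'⁻¹ : Matrix (Fin n) (Fin n) (ZMod q)) *ᵥ x.1, ?_⟩,
    fun x => ⟨(T' : Matrix (Fin n) (Fin n) (ZMod q)) *ᵥ x.1, ?_⟩, fun x => ?_, fun x => ?_⟩
  · rw [mulVec_mulVec, Matrix.mul_assoc, Units.mul_inv, Matrix.mul_one, ← mulVec_mulVec, x.2,
      mulVec_zero]
  · have := congrArg ((↑S'⁻¹ : Matrix (Fin n) (Fin n) (ZMod q)) *ᵥ ·) x.2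
    simpa [mulVec_mulVec, ← Matrix.mul_assoc] using this
  · simp
  · simp

theorem card_annihilator_zmod_le (q : ℕ) [NeZero q] (e : ℕ) :
    Nat.card {x : ZMod q // (e : ZMod q) * x = 0} ≤ q := by
  simpa using Nat.card_le_card_of_injective (Subtype.val : {x : ZMod q // (e : ZMod q) * x = 0} → _)
    Subtype.val_injective

theorem card_annihilator_zmod_eq_iff (q : ℕ) [NeZero q] (e : ℕ) :
    Nat.card {x : ZMod q // (e : ZMod q) * x = 0} = q ↔ q ∣ e := by
  rw [← ZMod.natCast_eq_zero_iff]
  constructor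
  · intro h
    have hb := ((Nat.bijective_iff_injective_and_card
      (Subtype.val : {x : ZMod q // (e : ZMod q) * x = 0} → ZMod q)).mpr
        ⟨Subtype.val_injective, by simpa using h⟩).surjective 1
    obtain ⟨x, hx⟩ := hb
    simpa [hx] using x.2
  · intro h
    simp [h]

/-- Uniqueness of the Smith normal form: modulo `q`, the `i`-th diagonal entry has at most `q`
annihilators, with equality exactly when `q` divides it, so the number of solutions of a diagonal
system modulo all `q` recovers a divisibility chain. Zero entries are allowed. -/
theorem UnimodularEquiv.diagonal_unique {n : ℕ} {e f : Fin n → ℕ}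
    (he : ∀ i j, i ≤ j → e i ∣ e j) (hf : ∀ i j, i ≤ j → f i ∣ f j)
    (h : UnimodularEquiv (diagonal fun i => (e i : ℤ)) (diagonal fun i => (f i : ℤ))) : e = f := by
  have hcard : ∀ q : ℕ, q ≠ 0 → ∏ i, Nat.card {x : ZMod q // (e i : ZMod q) * x = 0} =
      ∏ i, Nat.card {x : ZMod q // (f i : ZMod q) * x = 0} := fun q hq => by
    have : NeZero q := ⟨hq⟩
    have hmap : ∀ e : Fin n → ℕ, (diagonal fun i => (e i : ℤ)).map (Int.castRingHom (ZMod q)) =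
        diagonal fun i => (e i : ZMod q) := fun e => by
      rw [diagonal_map (map_zero _)]
      simp
    have := h.card_ker_zmod q
    rwa [hmap, hmap, card_ker_diagonal_zmod, card_ker_diagonal_zmod] at this
  have key : ∀ (e f : Fin n → ℕ), (∀ i j, i ≤ j → e i ∣ e j) →
      (∀ q : ℕ, q ≠ 0 → ∏ i, Nat.card {x : ZMod q // (e i : ZMod q) * x = 0} =
        ∏ i, Nat.card {x : ZMod q // (f i : ZMod q) * x = 0}) →
      ∀ i, (∀ j < i, e j = f j) → ∀ q ≠ 0, q ∣ e i → q ∣ f i := by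
    intro e f he hcard i hi q hq hqe
    have : NeZero q := ⟨hq⟩
    have hle : ∀ j ∈ Finset.univ, Nat.card {x : ZMod q // (f j : ZMod q) * x = 0} ≤
        Nat.card {x : ZMod q // (e j : ZMod q) * x = 0} := fun j _ => by
      by_cases hj : j < i
      · rw [hi j hj]
      · rw [(card_annihilator_zmod_eq_iff q (e j)).mpr (hqe.trans (he i j (not_lt.mp hj)))]
        exact card_annihilator_zmod_le q _
    by_contra hcon
    refine (Finset.prod_lt_prod (fun j _ => ?_) hle ⟨i, Finset.mem_univ i, ?_⟩).ne
      (hcard q hq).symm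
    · have : Nonempty {x : ZMod q // (f j : ZMod q) * x = 0} := ⟨0, by simp⟩
      exact Nat.card_pos
    · rw [(card_annihilator_zmod_eq_iff q (e i)).mpr hqe]
      exact lt_of_le_of_ne (card_annihilator_zmod_le q _)
        fun h => hcon ((card_annihilator_zmod_eq_iff q (f i)).mp h)
  -- Divisibility by every positive integer is divisibility, also when the dividend is zero.
  have hdvd : ∀ a b : ℕ, (∀ q ≠ 0, q ∣ a → q ∣ b) → a ∣ b := fun a b hab => by
    rcases eq_or_ne a 0 with rfl | ha
    · have := Nat.eq_zero_of_dvd_of_lt (hab (b + 1) (by simp) (dvd_zero _)) (Nat.lt_succ_self b)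
      simp [this]
    · exact hab a ha dvd_rfl
  funext i
  induction i using WellFoundedLT.induction with
  | _ i ih =>
    exact Nat.dvd_antisymm (hdvd _ _ (key e f he hcard i ih))
      (hdvd _ _ (key f e hf (fun q hq => (hcard q hq).symm) i fun j hj => (ih j hj).symm))

/-! ### A Schur complement over the integers -/

/-- Every integer vector is carried to a multiple of the first unit vector by an invertible
integer matrix. -/
theorem exists_isUnit_mulVec_eq_single {n : ℕ} (c : Fin (n + 1) → ℤ) :
    ∃ (V : Matrix (Fin (n + 1)) (Fin (n + 1)) ℤ) (g : ℤ), IsUnit V ∧ V *ᵥ c = Pi.single 0 g := by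
  -- Apply the Smith normal form to the matrix with first column `c` and zeros elsewhere.
  obtain ⟨e, he, S, T, hST⟩ := UnimodularEquiv.exists_diagonal (vecMulVec c (Pi.single 0 1))
  rw [mul_vecMulVec, vecMulVec_mul] at hST
  set u := (S : Matrix (Fin (n + 1)) (Fin (n + 1)) ℤ) *ᵥ c with hu
  set t := Pi.single (0 : Fin (n + 1)) (1 : ℤ) ᵥ* (T : Matrix (Fin (n + 1)) (Fin (n + 1)) ℤ) with ht
  have hut : ∀ i j, u i * t j = if i = j then (e i : ℤ) else 0 := fun i j => by
    have := congrFun (congrFun hST i) j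
    rwa [vecMulVec_apply, diagonal_apply] at this
  have ht0 : ∃ j, t j ≠ 0 := by
    by_contra! h
    have h0 : t = 0 := funext h
    have h1 := congrArg (· ᵥ* (↑T⁻¹ : Matrix (Fin (n + 1)) (Fin (n + 1)) ℤ)) h0
    simp only [ht, vecMul_vecMul, Units.mul_inv, vecMul_one, zero_vecMul] at h1
    simpa using congrFun h1 0
  have hez : ∀ i, i ≠ 0 → e i = 0 := fun i hi => by
    have h1 : (e 0 : ℤ) * e i = 0 := by
      have ha := hut 0 0
      have hb := hut i i
      have hc := hut 0 i
      rw [if_pos rfl] at ha hb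
      rw [if_neg (Ne.symm hi)] at hc
      rw [← ha, ← hb]
      linear_combination (u i * t 0) * hc
    rcases mul_eq_zero.mp h1 with h | h
    · have h0 := he 0 i (Fin.zero_le i)
      rw [Int.natCast_eq_zero.mp h] at h0
      exact Nat.eq_zero_of_zero_dvd h0
    · exact Int.natCast_eq_zero.mp h
  obtain ⟨j, hj⟩ := ht0
  refine ⟨S, u 0, S.isUnit, ?_⟩
  rw [← hu]
  funext i
  by_cases hi : i = 0
  · simp [hi]
  · rw [Pi.single_eq_of_ne hi]
    refine (mul_eq_zero.mp ((hut i j).trans ?_)).resolve_right hj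
    simp [hez i hi]

/-- A form of the fact that the semilocal ring `ℤ/d` has stable range one, obtained by lifting units
from `ℤ/gcd(y, d)` to `ℤ/d`. -/
theorem exists_isCoprime_add_mul {x y v : ℤ} {d : ℕ} (hd : d ≠ 0)
    (h : IsCoprime (x * v + y) (d : ℤ)) : ∃ s : ℤ, IsCoprime (v + s * y) (d : ℤ) := by
  have : NeZero d := ⟨hd⟩
  set g := Int.gcd y d with hg
  have hgd : g ∣ d := by exact_mod_cast Int.gcd_dvd_right y d
  have hv : IsCoprime v (g : ℤ) := by
    obtain ⟨a, b, hab⟩ := h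
    obtain ⟨p, hp⟩ : (g : ℤ) ∣ y := Int.gcd_dvd_left y d
    obtain ⟨q, hq⟩ : (g : ℤ) ∣ d := Int.gcd_dvd_right y d
    exact ⟨a * x, a * p + b * q, by linear_combination hab - a * hp - b * hq⟩
  obtain ⟨u, hu⟩ := ZMod.unitsMap_surjective hgd (ZMod.unitOfIsCoprime v hv)
  obtain ⟨w, hw⟩ := ZMod.intCast_surjective (u : ZMod d)
  have hwv : (w : ZMod g) = v := by
    have := congrArg Units.val hu
    rw [ZMod.unitsMap_val, ← hw, ZMod.cast_intCast hgd] at this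
    simpa using this
  have hwd : IsCoprime w (d : ℤ) := by
    refine ((ZMod.coe_int_isUnit_iff_isCoprime w d).mp ?_).symm
    exact hw ▸ u.isUnit
  obtain ⟨s, hs⟩ := (ZMod.intCast_eq_intCast_iff_dvd_sub _ _ _).mp hwv.symm
  refine ⟨s * Int.gcdA y d, ?_⟩
  have hb := Int.gcd_eq_gcd_ab y d
  have : v + s * Int.gcdA y d * y = w + (-(s * Int.gcdB y d)) * d := by
    linear_combination -hs - s * hb
  rw [this]
  exact hwd.add_mul_right_left _

/-- Scaling all columns but the first by `d` multiplies all invariant factors but the first by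
`d`, provided the corner entry is prime to `d`. If `N = P B Q` with `B` in Smith form, the
automorphisms of `B` suffice to make the first column of `Q` vanish modulo `d` below the corner;
then `Q` can be moved past the scaling matrix. -/
theorem UnimodularEquiv.mul_border_smul {n : ℕ} {N : Matrix (Fin (n + 1)) (Fin (n + 1)) ℤ} {d : ℕ}
    (hd : d ≠ 0) (hN : IsCoprime (N 0 0) (d : ℤ)) {β : Fin (n + 1) → ℤ} (hβ : ∀ i, β 0 ∣ β i)
    (h : UnimodularEquiv N (diagonal β)) :
    UnimodularEquiv (N * Matrix.border 1 0 0 ((d : ℤ) • 1))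
      (diagonal (Fin.cons (β 0) fun i => d * β i.succ)) := by
  obtain ⟨S, T, hST⟩ := h
  set P : Matrix (Fin (n + 1)) (Fin (n + 1)) ℤ := ↑S⁻¹ with hP
  set Q : Matrix (Fin (n + 1)) (Fin (n + 1)) ℤ := ↑T⁻¹ with hQ
  have hNPQ : N = P * diagonal β * Q := by
    rw [← hST]; simp [hP, hQ, Matrix.mul_assoc]
  choose b hb using fun i : Fin n => hβ i.succ
  have hB : diagonal β = Matrix.border (β 0) 0 0 (diagonal fun i => β 0 * b i) := by
    rw [border_diagonal]
    congr 1
    ext i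
    refine Fin.cases rfl (fun i => ?_) i
    simp [hb]
  have h00 : N 0 0 = β 0 * (P 0 0 * Q 0 0 + ∑ i : Fin n, P 0 i.succ * b i * Q i.succ 0) := by
    rw [hNPQ, Matrix.mul_apply, Fin.sum_univ_succ, mul_add, Finset.mul_sum]
    simp only [mul_diagonal, hb]
    congr 1
    · ring
    · exact Finset.sum_congr rfl fun i _ => by ring
  set y := ∑ i : Fin n, P 0 i.succ * b i * Q i.succ 0 with hy
  -- `X₁` and `Z₁` make the top entry of the first column of `Q` prime to `d`; `X₂` and `Z₂` then
  -- clear the other entries of that column modulo `d`. Both pairs satisfy `X * B = B * Z`.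
  obtain ⟨s, hs⟩ := exists_isCoprime_add_mul hd (hN.symm.of_isCoprime_of_dvd_right
    (h00 ▸ Dvd.intro_left _ rfl)).symm
  obtain ⟨w, z, hwz⟩ := hs
  set X₁ : Matrix (Fin (n + 1)) (Fin (n + 1)) ℤ :=
    Matrix.border 1 (fun i => s * P 0 i.succ) 0 1
  set Z₁ : Matrix (Fin (n + 1)) (Fin (n + 1)) ℤ :=
    Matrix.border 1 (fun i => s * P 0 i.succ * b i) 0 1 with hZ₁
  set X₂ : Matrix (Fin (n + 1)) (Fin (n + 1)) ℤ :=
    Matrix.border 1 0 (fun i => b i * (-(Q i.succ 0) * w)) 1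
  set Z₂ : Matrix (Fin (n + 1)) (Fin (n + 1)) ℤ :=
    Matrix.border 1 0 (fun i => -(Q i.succ 0) * w) 1 with hZ₂
  have hX₁ : X₁ * diagonal β = diagonal β * Z₁ := by
    rw [hB, border_mul, border_mul]
    refine ext_border (by simp) (fun j => ?_) (fun i => by simp) fun i j => by simp
    simp [vecMul_diagonal]
    ring
  have hX₂ : X₂ * diagonal β = diagonal β * Z₂ := by
    rw [hB, border_mul, border_mul]
    refine ext_border (by simp) (fun j => by simp) (fun i => ?_) fun i j => by simp
    simp [mulVec_diagonal]
    ring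
  have hX : IsUnit (X₂ * X₁) := (isUnit_border_col _).mul (isUnit_border_row _)
  have hZQ : IsUnit (Z₂ * Z₁ * Q) :=
    ((isUnit_border_col _).mul (isUnit_border_row _)).mul T⁻¹.isUnit
  set R := Z₂ * Z₁ * Q with hR
  have hR0 : ∀ i : Fin n, R i.succ 0 = d * (Q i.succ 0 * z) := fun i => by
    have hv0 : (Z₁ * Q) 0 0 = Q 0 0 + s * y := by
      rw [Matrix.mul_apply, Fin.sum_univ_succ, hZ₁, hy, Finset.mul_sum]
      simp only [border_zero_zero, border_zero_succ, one_mul]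
      congr 1
      exact Finset.sum_congr rfl fun i _ => by ring
    have hvi : ∀ i : Fin n, (Z₁ * Q) i.succ 0 = Q i.succ 0 := fun i => by
      rw [Matrix.mul_apply, Fin.sum_univ_succ, hZ₁]
      simp [Matrix.one_apply]
    rw [hR, Matrix.mul_assoc, Matrix.mul_apply, Fin.sum_univ_succ, hv0, hZ₂]
    simp only [border_succ_zero, border_succ_succ, hvi]
    simp only [Matrix.one_apply, ite_mul, one_mul, zero_mul, Finset.sum_ite_eq, Finset.mem_univ,
      if_true]
    linear_combination -(Q i.succ 0) * hwz
  set Δ : Matrix (Fin (n + 1)) (Fin (n + 1)) ℤ := Matrix.border 1 0 0 ((d : ℤ) • 1) with hΔ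
  set R' : Matrix (Fin (n + 1)) (Fin (n + 1)) ℤ := Matrix.border (R 0 0)
    (fun j => d * R 0 j.succ) (fun i => Q i.succ 0 * z) (R.submatrix Fin.succ Fin.succ) with hR'
  have hcomm : R * Δ = Δ * R' := by
    rw [eq_border R, border_mul, border_mul, Matrix.mul_smul, Matrix.smul_mul, Matrix.mul_one,
      Matrix.one_mul]
    refine ext_border (by simp) (fun j => ?_) (fun i => ?_) fun i j => by simp
    · simp [mul_comm]
    · simp [hR0]
  have hR'u : IsUnit R' := by
    rw [isUnit_iff_isUnit_det] at hZQ ⊢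
    have hdet := congrArg det hcomm
    -- Since `det Δ ≠ 0`, `R * Δ = Δ * R'` forces `det R' = det R`.
    have hΔ0 : Δ.det ≠ 0 := by
      have : Δ = diagonal (Fin.cons 1 fun _ => (d : ℤ)) := by
        rw [hΔ, smul_one_eq_diagonal, border_diagonal]
      rw [this, det_diagonal, Fin.prod_univ_succ]
      simp [hd]
    rw [det_mul R, det_mul Δ, mul_comm] at hdet
    rwa [← mul_left_cancel₀ hΔ0 hdet]
  have hBΔ : diagonal β * Δ = diagonal (Fin.cons (β 0) fun i => (d : ℤ) * β i.succ) := by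
    rw [hB, hΔ, smul_one_eq_diagonal, border_mul, diagonal_mul_diagonal, ← border_diagonal]
    simp [hb, mul_comm]
  set Y : Matrix (Fin (n + 1)) (Fin (n + 1)) ℤ := ↑hX.unit⁻¹ with hY
  have hYX : Y * (X₂ * X₁) = 1 := hX.unit.inv_mul
  refine symm (of_isUnit (S := P * Y) (S⁻¹.isUnit.mul hX.unit⁻¹.isUnit) hR'u ?_)
  calc P * Y * diagonal (Fin.cons (β 0) fun i => (d : ℤ) * β i.succ) * R'
      = P * Y * (diagonal β * Z₂) * Z₁ * Q * Δ := by
        simp only [← hBΔ, Matrix.mul_assoc, ← hcomm, hR]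
    _ = P * Y * X₂ * (diagonal β * Z₁) * Q * Δ := by
        rw [← hX₂]; simp only [Matrix.mul_assoc]
    _ = P * (Y * (X₂ * X₁)) * diagonal β * Q * Δ := by
        rw [← hX₁]; simp only [Matrix.mul_assoc]
    _ = N * Δ := by rw [hYX, Matrix.mul_one, ← hNPQ]

/-- For a matrix `L = [[d, -c], [-c, M]]` with `gcd (d, c) = 1`, the integral Schur complement
`d M - c cᵀ` has the invariant factors of `L` without the leading `1`, all but the first of them
multiplied by `d`. -/
theorem exists_diagonal_border_and_schur {n : ℕ} {d : ℕ} (hd : d ≠ 0) (c : Fin (n + 1) → ℤ)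
    (M : Matrix (Fin (n + 1)) (Fin (n + 1)) ℤ)
    (hgcd : ∀ g : ℤ, (∀ i, g ∣ c i) → g ∣ d → IsUnit g) :
    ∃ β : Fin (n + 1) → ℕ, (∀ i j, i ≤ j → β i ∣ β j) ∧
      UnimodularEquiv (border d (-c) (-c) M) (diagonal (Fin.cons 1 fun i => (β i : ℤ))) ∧
      UnimodularEquiv ((d : ℤ) • M - vecMulVec c c)
        (diagonal (Fin.cons (β 0 : ℤ) fun i => (d : ℤ) * β i.succ)) := by
  obtain ⟨V, g, hV, hVc⟩ := exists_isUnit_mulVec_eq_single c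
  have hcg : IsCoprime g (d : ℤ) := by
    rw [← isRelPrime_iff_isCoprime]
    refine fun p hpg hpd => hgcd p (fun i => ?_) hpd
    have h1 : c = (↑hV.unit⁻¹ : Matrix (Fin (n + 1)) (Fin (n + 1)) ℤ) *ᵥ Pi.single 0 g := by
      rw [← hVc, mulVec_mulVec, show _ * V = 1 from hV.unit.inv_mul, one_mulVec]
    rw [h1]
    simpa [mulVec_single] using hpg.mul_left _
  have hVt : IsUnit Vᵀ := by rwa [isUnit_iff_isUnit_det, det_transpose, ← isUnit_iff_isUnit_det]
  set M' := V * M * Vᵀ with hM'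
  set c' : Fin (n + 1) → ℤ := Pi.single 0 g with hc'
  have hL : UnimodularEquiv (border d (-c) (-c) M) (border d (-c') (-c') M') := by
    refine .of_isUnit (isUnit_border_block hV) (isUnit_border_block hVt) ?_
    rw [border_mul, border_mul]
    simp [vecMul_transpose, mulVec_neg, hVc, hM']
  have hS : UnimodularEquiv ((d : ℤ) • M - vecMulVec c c) ((d : ℤ) • M' - vecMulVec c' c') := by
    refine .of_isUnit hV hVt ?_
    rw [Matrix.mul_sub, Matrix.sub_mul, mul_vecMulVec, vecMulVec_mul, vecMul_transpose, hVc, hM',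
      Matrix.mul_smul, Matrix.smul_mul]
  obtain ⟨s, t, hst⟩ := hcg
  -- `U` acts on the first two columns only; it turns the first row of `L` into `(1, 0, …, 0)`.
  set U : Matrix (Fin (n + 2)) (Fin (n + 2)) ℤ :=
    border t (Pi.single 0 g) (Pi.single 0 (-s)) (border d 0 0 1) with hU
  have hUu : IsUnit U := by
    refine IsUnit.of_mul_eq_one (border d (Pi.single 0 (-g)) (Pi.single 0 s) (border t 0 0 1)) ?_
    have h2 : vecMulVec (Pi.single 0 (-s)) (Pi.single 0 (-g)) +
        border (d : ℤ) 0 0 1 * border t 0 0 (1 : Matrix (Fin n) (Fin n) ℤ) = 1 := by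
      rw [border_mul, ← border_one]
      refine ext_border ?_ (fun j => by simp [vecMulVec_apply])
        (fun i => by simp [vecMulVec_apply]) fun i j => by simp [vecMulVec_apply]
      simp [vecMulVec_apply]
      linear_combination hst
    have h1 : t • Pi.single (0 : Fin (n + 1)) (-g) + Pi.single 0 g ᵥ* border t 0 0 1 = 0 := by
      funext j
      refine Fin.cases ?_ (fun j => ?_) j <;> simp [mul_comm]
    have h3 : (d : ℤ) • Pi.single (0 : Fin (n + 1)) (-s) + border d 0 0 1 *ᵥ Pi.single 0 s = 0 := by
      funext j
      refine Fin.cases ?_ (fun j => ?_) j <;> simp [mul_comm]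
    rw [hU, border_mul, ← border_one, h1, h2, h3]
    congr 1
    simp
    linear_combination hst
  set N := M' * border d 0 0 1 - vecMulVec c' c' with hN
  have hLU : border d (-c') (-c') M' * U =
      border 1 0 (M' *ᵥ Pi.single 0 (-s) - t • c') 1 * border 1 0 0 N := by
    have h1 : (d : ℤ) • Pi.single 0 g + (-c') ᵥ* border d 0 0 1 = 0 := by
      funext j
      refine Fin.cases ?_ (fun j => ?_) j <;> simp [hc', neg_vecMul, mul_comm]
    rw [hU, border_mul, border_mul, h1]
    refine ext_border ?_ (fun j => by simp) (fun i => ?_) fun i j => ?_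
    · simp [hc']
      linear_combination hst
    · simp
      ring
    · simp [hN, hc', vecMulVec_apply]
      ring
  have hSN : (d : ℤ) • M' - vecMulVec c' c' = N * border 1 0 0 ((d : ℤ) • 1) := by
    have h1 : border (d : ℤ) 0 0 (1 : Matrix (Fin n) (Fin n) ℤ) * border 1 0 0 ((d : ℤ) • 1) =
        (d : ℤ) • 1 := by
      rw [border_mul, Matrix.one_mul, ← border_one]
      refine ext_border (by simp) (fun j => by simp) (fun i => by simp) fun i j => ?_
      simp only [border_succ_succ, Matrix.smul_apply, vecMulVec_zero, zero_add]
    rw [hN, Matrix.sub_mul, Matrix.mul_assoc, vecMulVec_mul]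
    congr 1
    · rw [h1, Matrix.mul_smul, Matrix.mul_one]
    · congr 1
      funext j
      refine Fin.cases ?_ (fun j => ?_) j <;> simp [hc']
  have hN00 : IsCoprime (N 0 0) (d : ℤ) := by
    have : N 0 0 = -(g * g) + M' 0 0 * d := by
      simp [hN, hc', Matrix.mul_apply, Fin.sum_univ_succ, vecMulVec_apply]
      ring
    rw [this]
    have h : IsCoprime g (d : ℤ) := ⟨s, t, hst⟩
    exact (h.mul_left h).neg_left.add_mul_right_left _
  obtain ⟨β, hβ, hNβ⟩ := UnimodularEquiv.exists_diagonal N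
  refine ⟨β, hβ, ?_, ?_⟩
  · refine hL.trans (.trans ?_ (border_diagonal 1 _ ▸ UnimodularEquiv.border 1 hNβ))
    exact (UnimodularEquiv.of_isUnit (S := 1) isUnit_one hUu (by rw [one_mul, hLU])).trans
      (UnimodularEquiv.symm (.of_isUnit (isUnit_border_col _) isUnit_one (Matrix.mul_one _)))
  · refine hS.trans (hSN ▸ UnimodularEquiv.mul_border_smul hd hN00 (fun i => ?_) hNβ)
    exact_mod_cast hβ 0 i (Fin.zero_le i)

end Matrix

/-! ### The rank of `L` -/

namespace ArithmeticalStructure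

variable {V : Type*} [Fintype V] [DecidableEq V] {G : Multigraph V}

theorem L_apply (a : ArithmeticalStructure G) (i j : V) :
    a.L i j = (if i = j then (a.d i : ℤ) else 0) - G.mult i j := by
  simp [L, Multigraph.adjMatrix, Matrix.diagonal_apply]

theorem L_mulVec_apply (a : ArithmeticalStructure G) (x : V → ℤ) (i : V) :
    (a.L.mulVec x) i = a.d i * x i - ∑ j, G.mult i j * x j := by
  simp [Matrix.mulVec, dotProduct, L_apply, sub_mul, Finset.sum_sub_distrib]

theorem L_mulVec_r (a : ArithmeticalStructure G) : a.L.mulVec (fun i => (a.r i : ℤ)) = 0 := by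
  funext i
  rw [L_mulVec_apply, Pi.zero_apply, sub_eq_zero]
  exact_mod_cast a.d_mul_r i

/-- Discrete maximum principle: the kernel of `L` consists of the multiples of `r`, because the
set of vertices where `x i / r i` is maximal is closed under adjacency. -/
theorem r_mul_eq_of_L_mulVec_eq_zero (a : ArithmeticalStructure G) (hG : G.Connected) {x : V → ℤ}
    (hx : a.L.mulVec x = 0) (i j : V) : a.r i * x j = a.r j * x i := by
  have hpos : ∀ i, (0 : ℤ) < a.r i := fun i => by exact_mod_cast a.r_pos i
  have hstep : ∀ i k, (∀ j, a.r i * x j ≤ a.r j * x i) → G.toSimpleGraph.Adj i k →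
      ∀ j, a.r k * x j ≤ a.r j * x k := by
    intro i k hi hik j
    have hsum : ∑ j, (G.mult i j : ℤ) * (a.r j * x i - a.r i * x j) = 0 := by
      have h1 := congrFun hx i
      rw [L_mulVec_apply] at h1
      have h2 : (a.d i : ℤ) * a.r i = ∑ j, (G.mult i j : ℤ) * a.r j := by
        exact_mod_cast a.d_mul_r i
      have h3 : ∑ j, (G.mult i j : ℤ) * (a.r j * x i - a.r i * x j) =
          (∑ j, (G.mult i j : ℤ) * a.r j) * x i - a.r i * ∑ j, (G.mult i j : ℤ) * x j := by
        rw [Finset.sum_mul, Finset.mul_sum, ← Finset.sum_sub_distrib]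
        exact Finset.sum_congr rfl fun j _ => by ring
      rw [h3, ← h2]
      simp only [Pi.zero_apply] at h1
      linear_combination (a.r i : ℤ) * h1
    have hk := (Finset.sum_eq_zero_iff_of_nonneg fun j _ =>
      mul_nonneg (Nat.cast_nonneg _) (sub_nonneg.mpr (hi j))).mp hsum k (Finset.mem_univ k)
    have hk' : a.r k * x i - a.r i * x k = 0 :=
      (mul_eq_zero.mp hk).resolve_left (by exact_mod_cast hik)
    refine le_of_mul_le_mul_left ?_ (hpos i)
    calc (a.r i : ℤ) * (a.r k * x j) = a.r k * (a.r i * x j) := by ring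
      _ ≤ a.r k * (a.r j * x i) := mul_le_mul_of_nonneg_left (hi j) (hpos k).le
      _ = a.r i * (a.r j * x k) := by linear_combination (a.r j : ℤ) * hk'
  have : Nonempty V := ⟨i⟩
  obtain ⟨i₀, hi₀⟩ := Finite.exists_max fun i => (x i : ℚ) / a.r i
  have hmax : ∀ j, a.r i₀ * x j ≤ a.r j * x i₀ := fun j => by
    have h := hi₀ j
    rw [div_le_div_iff₀ (by exact_mod_cast a.r_pos j) (by exact_mod_cast a.r_pos i₀)] at h
    have h' : x j * a.r i₀ ≤ x i₀ * a.r j := by exact_mod_cast h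
    linarith
  have hall : ∀ k, ∀ j, a.r k * x j ≤ a.r j * x k := fun k => by
    have hreach := (SimpleGraph.reachable_iff_reflTransGen i₀ k).mp (hG.preconnected i₀ k)
    induction hreach with
    | refl => exact hmax
    | tail _ h ih => exact hstep _ _ ih h
  exact le_antisymm (hall i j) (hall j i)

/-- The matrix `L` has corank one: only the last entry of its diagonal form vanishes. -/
theorem diagonal_eq_zero_iff {m : ℕ} {G : Multigraph (Fin (m + 1))} (a : ArithmeticalStructure G)
    (hG : G.Connected) {e : Fin (m + 1) → ℕ} (he : ∀ i j, i ≤ j → e i ∣ e j)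
    (h : Matrix.UnimodularEquiv a.L (Matrix.diagonal fun i => (e i : ℤ))) (i : Fin (m + 1)) :
    e i = 0 ↔ i = Fin.last m := by
  obtain ⟨S, T, hST⟩ := h
  have hrpos : ∀ i, (a.r i : ℤ) ≠ 0 := fun i => by exact_mod_cast (a.r_pos i).ne'
  have hker : ∀ i, e i = 0 → a.L.mulVec
      ((T : Matrix (Fin (m + 1)) (Fin (m + 1)) ℤ).mulVec (Pi.single i 1)) = 0 := fun i hi => by
    have h1 : (S : Matrix (Fin (m + 1)) (Fin (m + 1)) ℤ).mulVec (a.L.mulVec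
        ((T : Matrix (Fin (m + 1)) (Fin (m + 1)) ℤ).mulVec (Pi.single i 1))) = 0 := by
      rw [Matrix.mulVec_mulVec, Matrix.mulVec_mulVec, hST]
      funext j
      rcases eq_or_ne j i with rfl | hj
      · simp [Matrix.mulVec_diagonal, hi]
      · simp [Matrix.mulVec_diagonal, hj]
    have h2 := congrArg (↑S⁻¹ : Matrix (Fin (m + 1)) (Fin (m + 1)) ℤ).mulVec h1
    simpa [Matrix.mulVec_mulVec, ← Matrix.mul_assoc] using h2
  have hinj : Function.Injective (T : Matrix (Fin (m + 1)) (Fin (m + 1)) ℤ).mulVec :=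
    Matrix.mulVec_injective_of_isUnit T.isUnit
  have hlast : e (Fin.last m) = 0 := by
    set z := (↑T⁻¹ : Matrix (Fin (m + 1)) (Fin (m + 1)) ℤ).mulVec (fun i => (a.r i : ℤ)) with hz
    have hDz : ∀ i, (e i : ℤ) * z i = 0 := fun i => by
      have h1 : (Matrix.diagonal fun i => (e i : ℤ)).mulVec z = 0 := by
        rw [← hST, hz, Matrix.mulVec_mulVec, Matrix.mul_assoc, Units.mul_inv, Matrix.mul_one,
          ← Matrix.mulVec_mulVec, L_mulVec_r, Matrix.mulVec_zero]
      simpa [Matrix.mulVec_diagonal] using congrFun h1 i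
    have hz0 : ∃ i, z i ≠ 0 := by
      by_contra! h0
      have h1 : (T : Matrix (Fin (m + 1)) (Fin (m + 1)) ℤ).mulVec z = 0 := by
        rw [show z = 0 from funext h0, Matrix.mulVec_zero]
      rw [hz, Matrix.mulVec_mulVec, Units.mul_inv, Matrix.one_mulVec] at h1
      exact hrpos 0 (congrFun h1 0)
    obtain ⟨i, hi⟩ := hz0
    have := he i (Fin.last m) (Fin.le_last i)
    rw [Int.natCast_eq_zero.mp ((mul_eq_zero.mp (hDz i)).resolve_right hi)] at this
    exact Nat.eq_zero_of_zero_dvd this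
  refine ⟨fun hi => ?_, fun hi => hi ▸ hlast⟩
  by_contra hne
  -- Two unit vectors in the kernel of the diagonal matrix would give two independent vectors in
  -- the kernel of `L`.
  set x := (T : Matrix (Fin (m + 1)) (Fin (m + 1)) ℤ).mulVec (Pi.single i 1) with hx
  set y := (T : Matrix (Fin (m + 1)) (Fin (m + 1)) ℤ).mulVec (Pi.single (Fin.last m) 1) with hy
  have hxr := a.r_mul_eq_of_L_mulVec_eq_zero hG (hker i hi)
  have hyr := a.r_mul_eq_of_L_mulVec_eq_zero hG (hker _ hlast)
  have hxy : y 0 • x = x 0 • y := by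
    funext j
    refine mul_left_cancel₀ (hrpos 0) ?_
    simp only [Pi.smul_apply, smul_eq_mul]
    linear_combination y 0 * hxr 0 j - x 0 * hyr 0 j
  rw [hx, hy, ← Matrix.mulVec_smul, ← Matrix.mulVec_smul, ← hx, ← hy] at hxy
  have hx0 : x 0 = 0 := by
    have := congrFun (hinj hxy) (Fin.last m)
    simpa [Pi.single_apply, Ne.symm hne] using this.symm
  have hxz : x = 0 := funext fun j => by
    have := hxr 0 j
    rw [← hx, hx0, mul_zero] at this
    exact (mul_eq_zero.mp this).resolve_left (hrpos 0)
  have h1 : Pi.single i (1 : ℤ) = 0 := hinj (by rw [← hx, hxz, Matrix.mulVec_zero])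
  simpa using congrFun h1 i

end ArithmeticalStructure

namespace Matrix

/-! ### The torsion of a cokernel -/

/-- The torsion subgroup of the cokernel of a square integer matrix with diagonal form `e` is the
product of the groups `ℤ/(e i)` over the nonzero `e i`. The index type `ι` enumerates the
nonzero entries. -/
theorem UnimodularEquiv.nonempty_torsion_addEquiv {n : ℕ} {ι : Type*} {A : Matrix (Fin n) (Fin n) ℤ}
    {e : Fin n → ℕ} (h : UnimodularEquiv A (diagonal fun i => (e i : ℤ))) (f : ι → Fin n)
    (hf : Function.Injective f) (hfe : ∀ i, e i ≠ 0 ↔ i ∈ Set.range f)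
    {g : ι → ℕ} (hg : ∀ x, e (f x) = g x) :
    Nonempty (AddCommGroup.torsion ((Fin n → ℤ) ⧸ LinearMap.range A.mulVecLin) ≃+
      ∀ x, ZMod (g x)) := by
  obtain rfl : (fun x => e (f x)) = g := funext hg
  obtain ⟨S, T, hST⟩ := h
  set S' : Matrix (Fin n) (Fin n) ℤ := ↑S with hS'
  have hmem : ∀ x : Fin n → ℤ, x ∈ LinearMap.range A.mulVecLin ↔
      ∀ i, (e i : ℤ) ∣ (S' *ᵥ x) i := fun x => by
    constructor
    · rintro ⟨z, rfl⟩ i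
      refine ⟨((↑T⁻¹ : Matrix (Fin n) (Fin n) ℤ) *ᵥ z) i, ?_⟩
      rw [← mulVec_diagonal (fun i => (e i : ℤ)), ← hST]
      simp [mulVec_mulVec, Matrix.mul_assoc]
    · intro hx
      choose z hz using hx
      refine ⟨(T : Matrix (Fin n) (Fin n) ℤ) *ᵥ z, ?_⟩
      have h1 : S' *ᵥ x = (diagonal fun i => (e i : ℤ)) *ᵥ z := by
        funext i
        rw [mulVec_diagonal, hz]
      have h2 := congrArg ((↑S⁻¹ : Matrix (Fin n) (Fin n) ℤ) *ᵥ ·) h1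
      rw [← hST] at h2
      simpa [mulVec_mulVec, ← Matrix.mul_assoc, hS'] using h2.symm
  let φ : (Fin n → ℤ) →ₗ[ℤ] ∀ x, ZMod (e (f x)) :=
    (AddMonoidHom.mk' (fun v x => (((S' *ᵥ v) (f x) : ℤ) : ZMod (e (f x)))) fun v w => by
      funext x
      simp [mulVec_add]).toIntLinearMap
  have hφ : ∀ v x, φ v x = (((S' *ᵥ v) (f x) : ℤ) : ZMod (e (f x))) := fun _ _ => rfl
  let Φ := (LinearMap.range A.mulVecLin).liftQ φ fun v hv => by
    rw [LinearMap.mem_ker]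
    funext x
    rw [hφ]
    exact (ZMod.intCast_zmod_eq_zero_iff_dvd _ _).mpr ((hmem v).mp hv (f x))
  refine ⟨AddEquiv.ofBijective (Φ.toAddMonoidHom.comp
    (AddCommGroup.torsion ((Fin n → ℤ) ⧸ LinearMap.range A.mulVecLin)).subtype) ⟨?_, ?_⟩⟩
  · rw [injective_iff_map_eq_zero]
    rintro ⟨q, hq⟩ h0
    obtain ⟨v, rfl⟩ := Submodule.Quotient.mk_surjective _ q
    replace h0 : φ v = 0 := h0
    obtain ⟨N, hN, hNv⟩ := isOfFinAddOrder_iff_nsmul_eq_zero.mp hq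
    rw [← Submodule.Quotient.mk_smul, Submodule.Quotient.mk_eq_zero, hmem] at hNv
    refine Subtype.ext ((Submodule.Quotient.mk_eq_zero _).mpr ((hmem v).mpr fun i => ?_))
    by_cases hi : e i = 0
    · -- A torsion class has zero coordinates in the free part.
      have := hNv i
      rw [hi, Nat.cast_zero, zero_dvd_iff, mulVec_smul, Pi.smul_apply, nsmul_eq_mul] at this
      rw [hi, Nat.cast_zero, (mul_eq_zero.mp this).resolve_left (by exact_mod_cast hN.ne')]
    · obtain ⟨x, rfl⟩ := (hfe i).mp hi
      exact (ZMod.intCast_zmod_eq_zero_iff_dvd _ _).mp (congrFun h0 x)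
  · intro y
    choose u hu using fun x => ZMod.intCast_surjective (y x)
    let w : Fin n → ℤ := Function.extend f u 0
    let v := (↑S⁻¹ : Matrix (Fin n) (Fin n) ℤ) *ᵥ w
    have hSv : S' *ᵥ v = w := by simp [v, hS', mulVec_mulVec]
    have hw0 : ∀ i, e i = 0 → w i = 0 := fun i hi =>
      Function.extend_apply' _ _ _ fun hx => ((hfe i).mpr hx) hi
    have htor : Submodule.Quotient.mk v ∈
        AddCommGroup.torsion ((Fin n → ℤ) ⧸ LinearMap.range A.mulVecLin) := by
      refine isOfFinAddOrder_iff_nsmul_eq_zero.mpr ⟨∏ i, if e i = 0 then 1 else e i,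
        Finset.prod_pos fun i _ => by split_ifs <;> lia, ?_⟩
      rw [← Submodule.Quotient.mk_smul, Submodule.Quotient.mk_eq_zero, hmem]
      intro i
      rw [mulVec_smul, Pi.smul_apply, nsmul_eq_mul, hSv]
      by_cases hi : e i = 0
      · simp [hw0 i hi]
      · refine Dvd.dvd.mul_right ?_ _
        have := Finset.dvd_prod_of_mem (fun i => if e i = 0 then 1 else e i) (Finset.mem_univ i)
        rw [if_neg hi] at this
        exact_mod_cast this
    refine ⟨⟨_, htor⟩, ?_⟩
    change φ v = y
    funext x
    rw [hφ, hSv, show w (f x) = u x from hf.extend_apply u 0 x]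
    exact hu x

end Matrix

/-! ### Invariant factors and the star-clique operation -/

namespace IsInvariantFactors

variable {n t : ℕ} {B : Matrix (Fin n) (Fin n) ℤ} {α : ℕ → ℕ} {e : Fin n → ℕ}

/-- A diagonal form along a divisibility chain with `t` nonzero entries provides invariant
factors; the values of `α` outside `1, …, t` play no role. -/
theorem exists_of_diagonal (ht : t ≤ n) (he : ∀ i j, i ≤ j → e i ∣ e j)
    (he0 : ∀ i, e i ≠ 0 ↔ (i : ℕ) < t)
    (h : Matrix.UnimodularEquiv B (Matrix.diagonal fun i => (e i : ℤ))) :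
    ∃ α, IsInvariantFactors B t α := by
  refine ⟨fun k => if hk : k - 1 < n then e ⟨k - 1, hk⟩ else 0, ht, ht, fun k h1 hk => ?_,
    fun k h1 hk => ?_, ?_⟩
  · rw [dif_pos (by lia)]
    exact Nat.pos_of_ne_zero ((he0 _).mpr (by simp only; lia))
  · rw [dif_pos (by lia), dif_pos (by lia)]
    exact he _ _ (by simp only [Fin.mk_le_mk]; lia)
  · obtain ⟨S, T, hST⟩ := h
    refine ⟨S, T, hST.trans ?_⟩
    ext i j
    simp only [Matrix.diagonal_apply, Matrix.of_apply, Fin.ext_iff, Nat.add_sub_cancel, i.isLt,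
      dif_pos, Fin.eta]
    by_cases hi : (i : ℕ) < t
    · simp [hi]
    · simp [hi, not_not.mp (mt (he0 i).mp hi)]

theorem dvd_of_le (h : IsInvariantFactors B t α) {k l : ℕ} (hk : 1 ≤ k) (hkl : k ≤ l)
    (hl : l ≤ t) : α k ∣ α l := by
  induction l, hkl using Nat.le_induction with
  | base => exact dvd_rfl
  | succ l hkl ih => exact (ih (by lia)).trans (h.dvd l (by lia) (by lia))

/-- Invariant factors are read off from any diagonal form whose entries form a divisibility
chain. -/
theorem eq_diagonal (h : IsInvariantFactors B t α) (he : ∀ i j, i ≤ j → e i ∣ e j)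
    (hB : Matrix.UnimodularEquiv B (Matrix.diagonal fun i => (e i : ℤ))) (i : Fin n)
    (hi : (i : ℕ) < t) : α (i + 1) = e i := by
  have hα : Matrix.UnimodularEquiv B (Matrix.diagonal fun i : Fin n =>
      ((if (i : ℕ) < t then α (i + 1) else 0 : ℕ) : ℤ)) := by
    obtain ⟨S, T, hST⟩ := h.smith
    refine ⟨S, T, hST.trans ?_⟩
    ext i j
    by_cases hij : i = j <;> by_cases hi : (i : ℕ) < t <;>
      simp [hij, hi, Fin.val_inj]
  have huniq := (hα.symm.trans hB).diagonal_unique (fun i j hij => ?_) he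
  · simpa [hi] using congrFun huniq i
  · by_cases hj : (j : ℕ) < t
    · have hij' : (i : ℕ) ≤ j := hij
      rw [if_pos hj, if_pos (by lia)]
      exact h.dvd_of_le (by lia) (by lia) (by lia)
    · rw [if_neg hj]
      exact dvd_zero _

end IsInvariantFactors

namespace ArithmeticalStructure

variable {m : ℕ} {G : Multigraph (Fin (m + 1))}

/-- In a connected simple graph the last vertex has a neighbour, which contributes an entry `-1`. -/
theorem rowGcd_L_last_eq_one_of_isSimple (a : ArithmeticalStructure G) (hm : 0 < m)
    (hG : G.Connected) (hs : G.IsSimple) : rowGcd a.L (Fin.last m) = 1 := by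
  have hne : Fin.last m ≠ 0 := by
    rw [Ne, Fin.ext_iff]
    simpa using hm.ne'
  have h := (SimpleGraph.reachable_iff_reflTransGen _ _).mp (hG.preconnected (Fin.last m) 0)
  obtain ⟨j, hj, -⟩ := h.cases_head.resolve_left hne
  have hj1 : G.mult (Fin.last m) j = 1 :=
    le_antisymm (hs _ _) (Nat.one_le_iff_ne_zero.mpr hj)
  have hlj : Fin.last m ≠ j := fun h => by
    rw [← h, G.loopless] at hj1
    exact zero_ne_one hj1
  have hdvd : rowGcd a.L (Fin.last m) ∣ a.L (Fin.last m) j :=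
    Finset.gcd_dvd (Finset.mem_univ j)
  rw [L_apply, if_neg hlj, hj1, zero_sub, Nat.cast_one, dvd_neg] at hdvd
  have hnorm : normalize (rowGcd a.L (Fin.last m)) = rowGcd a.L (Fin.last m) :=
    Finset.normalize_gcd
  rw [← hnorm]
  exact normalize_eq_one.mpr (isUnit_of_dvd_one hdvd)

/-- If the last entry of `d` were zero, then `L r = 0` would make the last row of `L` vanish. -/
theorem d_last_ne_zero (a : ArithmeticalStructure G) (h : rowGcd a.L (Fin.last m) = 1) :
    a.d (Fin.last m) ≠ 0 := by
  intro hd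
  have hr := a.d_mul_r (Fin.last m)
  rw [hd, zero_mul, eq_comm, Finset.sum_eq_zero_iff] at hr
  have h0 : rowGcd a.L (Fin.last m) = 0 := by
    refine Finset.gcd_eq_zero_iff.mpr fun j _ => ?_
    have hj := (Nat.mul_eq_zero.mp (hr j (Finset.mem_univ j))).resolve_right (a.r_pos j).ne'
    simp [L_apply, hd, hj]
  exact one_ne_zero (h.symm.trans h0)

/-- Moving the last vertex to the front puts its entry of `d` into the corner of `L`. -/
theorem unimodularEquiv_border_L (a : ArithmeticalStructure G) :
    Matrix.UnimodularEquiv a.L (Matrix.border (a.d (Fin.last m))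
      (-fun i => (G.mult (Fin.last m) i.castSucc : ℤ))
      (-fun i => (G.mult (Fin.last m) i.castSucc : ℤ))
      (a.L.submatrix Fin.castSucc Fin.castSucc)) := by
  have h0 : (finRotate (m + 1)).symm 0 = Fin.last m := by
    rw [Equiv.symm_apply_eq, finRotate_last]
  have h1 : ∀ i : Fin m, (finRotate (m + 1)).symm i.succ = i.castSucc := fun i => by
    rw [Equiv.symm_apply_eq, finRotate_apply, Fin.coeSucc_eq_succ]
  have h := Matrix.UnimodularEquiv.submatrix a.L (finRotate (m + 1)).symm (finRotate (m + 1)).symm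
  convert h using 1
  refine Matrix.ext_border ?_ (fun j => ?_) (fun i => ?_) fun i j => ?_
  · simp [h0, L_apply, G.loopless]
  · simp [h0, h1, L_apply, (Fin.castSucc_ne_last j).symm]
  · simp [h0, h1, L_apply, Fin.castSucc_ne_last, G.symm i.castSucc]
  · simp only [Matrix.border_succ_succ, Matrix.submatrix_apply, h1]

/-- The matrix of the star-clique operation is an integral Schur complement in `L`. -/
theorem L_starClique (a : ArithmeticalStructure G) (hm : 0 < m) :
    (a.starClique hm).L = (a.d (Fin.last m) : ℤ) • a.L.submatrix Fin.castSucc Fin.castSucc -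
      Matrix.vecMulVec (fun i => (G.mult (Fin.last m) i.castSucc : ℤ))
        (fun i => (G.mult (Fin.last m) i.castSucc : ℤ)) := by
  ext i j
  simp only [L_apply, Matrix.sub_apply, Matrix.smul_apply, Matrix.submatrix_apply,
    Matrix.vecMulVec_apply, Fin.castSucc_inj, smul_eq_mul]
  by_cases h : i = j
  · subst h
    simp only [starClique, Multigraph.starClique, if_true, G.loopless]
    rw [Nat.cast_sub (a.mult_mul_mult_le i), G.symm i.castSucc (Fin.last m)]
    push_cast
    ring
  · simp only [Multigraph.starClique, if_neg h, G.symm i.castSucc (Fin.last m)]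
    push_cast
    ring

/-- If the last row of `L` has greatest common divisor `1`, then `L` and the matrix of the
star-clique operation have diagonal forms `1, β 0, β 1, …` and `β 0, d * β 1, d * β 2, …`. -/
theorem exists_diagonal_L_starClique {k : ℕ} {G : Multigraph (Fin (k + 2))}
    (a : ArithmeticalStructure G) (h : rowGcd a.L (Fin.last (k + 1)) = 1) :
    ∃ β : Fin (k + 1) → ℕ, (∀ i j, i ≤ j → β i ∣ β j) ∧
      Matrix.UnimodularEquiv a.L
        (Matrix.diagonal fun i => ((Fin.cons 1 β : Fin (k + 2) → ℕ) i : ℤ)) ∧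
      Matrix.UnimodularEquiv (a.starClique k.succ_pos).L (Matrix.diagonal fun i =>
        ((Fin.cons (β 0) fun j => a.d (Fin.last (k + 1)) * β j.succ : Fin (k + 1) → ℕ) i : ℤ)) := by
  obtain ⟨β, hβ, hL, hS⟩ := Matrix.exists_diagonal_border_and_schur (a.d_last_ne_zero h)
    (fun i => (G.mult (Fin.last (k + 1)) i.castSucc : ℤ))
    (a.L.submatrix Fin.castSucc Fin.castSucc) fun g hg hgd => by
      refine isUnit_of_dvd_one (h ▸ Finset.dvd_gcd fun j _ => ?_)
      refine Fin.lastCases ?_ (fun j => ?_) j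
      · simpa [L_apply, G.loopless] using hgd
      · simpa [L_apply, (Fin.castSucc_ne_last j).symm] using hg j
  refine ⟨β, hβ, ?_, ?_⟩
  · convert a.unimodularEquiv_border_L.trans hL using 2
    funext i
    refine Fin.cases ?_ (fun i => ?_) i <;> simp
  · rw [L_starClique]
    convert hS using 2
    funext i
    refine Fin.cases ?_ (fun i => ?_) i <;> simp

end ArithmeticalStructure

/-- The graph `G` has `n = m + 1 ≥ 3` vertices and the operation is performed at the last
vertex `v_n = Fin.last m`; hence `n - 1 = m` and `n - 2 = m - 1`. -/
theorem corollary4p6 (m : ℕ) (hm : 2 ≤ m) (G : Multigraph (Fin (m + 1)))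
    (hG : G.Connected) (a : ArithmeticalStructure G)
    (a' : ArithmeticalStructure (G.starClique (a.d (Fin.last m))))
    (ha' : a' = a.starClique (Nat.lt_of_lt_of_le Nat.zero_lt_two hm)) :
    (G.IsSimple → rowGcd a.L (Fin.last m) = 1) ∧
    (rowGcd a.L (Fin.last m) = 1 →
      (∃ α : ℕ → ℕ, IsInvariantFactors a.L m α) ∧
      (∃ α' : ℕ → ℕ, IsInvariantFactors a'.L (m - 1) α') ∧
      ∀ α α' : ℕ → ℕ, IsInvariantFactors a.L m α → IsInvariantFactors a'.L (m - 1) α' →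
        α' 1 = α 2 ∧
        (∀ k, 2 ≤ k → k ≤ m - 1 → α' k = a.d (Fin.last m) * α (k + 1)) ∧
        Nonempty (a'.CriticalGroup ≃+
          ZMod (α 2) ×
            (⨁ k : Finset.Icc 2 (m - 1), ZMod (a.d (Fin.last m) * α ((k : ℕ) + 1))))) := by
  refine ⟨a.rowGcd_L_last_eq_one_of_isSimple (by lia) hG, fun hrow => ?_⟩
  subst ha'
  obtain ⟨k, rfl⟩ : ∃ k, m = k + 1 := ⟨m - 1, by lia⟩
  rw [Nat.add_sub_cancel]
  have hd := a.d_last_ne_zero hrow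
  obtain ⟨β, hβ, hL, hL'⟩ := a.exists_diagonal_L_starClique hrow
  set d := a.d (Fin.last (k + 1)) with hd_def
  set e : Fin (k + 2) → ℕ := Fin.cons 1 β with he_def
  set e' : Fin (k + 1) → ℕ := Fin.cons (β 0) fun j => d * β j.succ with he'_def
  have he : ∀ i j, i ≤ j → e i ∣ e j := fun i j => by
    refine Fin.cases (fun _ => by simp [he_def]) (fun i => ?_) i
    refine Fin.cases (fun h => absurd h (by simp)) (fun j h => ?_) j
    simpa [he_def] using hβ i j (Fin.succ_le_succ_iff.mp h)
  have he' : ∀ i j, i ≤ j → e' i ∣ e' j := fun i j => by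
    refine Fin.cases (fun _ => ?_) (fun i => ?_) i
    · refine Fin.cases ?_ (fun j => ?_) j
      · simp
      · simpa [he'_def] using (hβ 0 j.succ (Fin.zero_le _)).mul_left d
    · refine Fin.cases (fun h => absurd h (by simp)) (fun j h => ?_) j
      simpa [he'_def] using Nat.mul_dvd_mul_left d (hβ i.succ j.succ h)
  have he0 : ∀ i, e i ≠ 0 ↔ (i : ℕ) < k + 1 := fun i => by
    rw [Ne, a.diagonal_eq_zero_iff hG he hL i, Fin.ext_iff, Fin.val_last]
    lia
  have hβ0 : ∀ i, β i ≠ 0 ↔ (i : ℕ) < k := fun i => by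
    simpa [he_def] using he0 i.succ
  have he'0 : ∀ i, e' i ≠ 0 ↔ (i : ℕ) < k := fun i => by
    refine Fin.cases ?_ (fun i => ?_) i
    · simpa [he'_def] using hβ0 0
    · simpa [he'_def, hd] using hβ0 i.succ
  refine ⟨IsInvariantFactors.exists_of_diagonal (by lia) he he0 hL,
    IsInvariantFactors.exists_of_diagonal (by lia) he' he'0 hL', fun α α' hα hα' => ?_⟩
  have hαβ : ∀ i (hi : i < k), α (i + 2) = β ⟨i, by lia⟩ := fun i hi =>
    hα.eq_diagonal he hL (Fin.succ ⟨i, by lia⟩) (by simpa using hi)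
  have he'1 : e' 0 = α 2 := (hαβ 0 (by lia)).symm
  have he'2 : ∀ j (hj : 2 ≤ j) (hjk : j ≤ k), e' ⟨j - 1, by lia⟩ = d * α (j + 1) := by
    intro j hj hjk
    obtain ⟨i, rfl⟩ : ∃ i, j = i + 2 := ⟨j - 2, by lia⟩
    rw [hαβ (i + 1) (by lia)]
    rfl
  refine ⟨(hα'.eq_diagonal he' hL' 0 (by rw [Fin.val_zero]; lia)).trans he'1,
    fun j hj hjk => ?_, ?_⟩
  · rw [← he'2 j hj hjk, ← hα'.eq_diagonal he' hL' ⟨j - 1, by lia⟩ (by simp only; lia)]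
    congr 1
    simp only
    lia
  · -- `none` enumerates the first diagonal entry and `some j` the entry of index `j - 1`.
    let f : Option (Finset.Icc 2 k) → Fin (k + 1) := fun x =>
      x.elim 0 fun j => ⟨j - 1, by have := Finset.mem_Icc.mp j.2; lia⟩
    let g : Option (Finset.Icc 2 k) → ℕ := fun x => x.elim (α 2) fun j => d * α (j + 1)
    have hf : Function.Injective f := by
      rintro (_ | ⟨i, hi⟩) (_ | ⟨j, hj⟩) hij
      · rfl
      · simp only [Finset.mem_Icc, f, Option.elim, Fin.ext_iff, Fin.val_zero] at hj hij
        lia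
      · simp only [Finset.mem_Icc, f, Option.elim, Fin.ext_iff, Fin.val_zero] at hi hij
        lia
      · simp only [Finset.mem_Icc, f, Option.elim, Fin.ext_iff] at hi hj hij
        congr 2
        lia
    have hfe : ∀ i, e' i ≠ 0 ↔ i ∈ Set.range f := by
      intro i
      rw [he'0]
      constructor
      · intro hi
        by_cases h0 : i = 0
        · exact ⟨none, h0.symm⟩
        · have : (i : ℕ) ≠ 0 := fun h => h0 (Fin.ext h)
          exact ⟨some ⟨i + 1, Finset.mem_Icc.mpr (by lia)⟩, Fin.ext (by simp [f])⟩
      · rintro ⟨_ | ⟨j, hj⟩, rfl⟩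
        · simp only [f, Option.elim, Fin.val_zero]
          lia
        · have := Finset.mem_Icc.mp hj
          simp only [f, Option.elim]
          lia
    have hg : ∀ x, e' (f x) = g x := by
      rintro (_ | ⟨j, hj⟩)
      · exact he'1
      · have := Finset.mem_Icc.mp hj
        exact he'2 j this.1 this.2
    obtain ⟨E⟩ := hL'.nonempty_torsion_addEquiv f hf hfe hg
    let E₁ : (∀ x, ZMod (g x)) ≃+ ZMod (α 2) × ∀ j : Finset.Icc 2 k, ZMod (d * α (j + 1)) :=
      { Equiv.piOptionEquivProd with map_add' := fun _ _ => rfl }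
    exact ⟨(E.trans E₁).trans ((AddEquiv.refl _).prodCongr
      (DirectSum.addEquivProd fun j : Finset.Icc 2 k => ZMod (d * α (j + 1))).symm)⟩
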